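/- Let $p$ be an odd prime, and let $\Gamma_p:\mathbb{Z}_p\to\mathbb{Z}_p$ be Morita's $p$-adic Gamma function, that is, the continuous function given on natural numbers $n$ by $$\Gamma_p(n)=(-1)^n\prod_{\substack{0<j<n\\ p\nmid j}} j \qquad(\Gamma_p(0)=1),$$ and extended to $x\in\mathbb{Z}_p$ by $\Gamma_p(x)=\lim_{n\to x}\Gamma_p(n)$, where $n$ runs through natural numbers tending $p$-adically to $x$. Then $$\sum_{k=0}^{(p-1)/2}(4k+1)\binom{-1/2}{k}^5\equiv\begin{cases}-\dfrac{p}{\Gamma_p(3/4)^4}\pmod{p^3} & \text{if } p\equiv 1\pmod 4,\\[2mm] 0\pmod{p^3} & \text{if } p\equiv 3\pmod 4,\end{cases}$$ where $\binom{-1/2}{k}$ is the generalized binomial coefficient and, for $a,b\in\mathbb{Q}_p$, $a\equiv b\pmod{p^3}$ means $a-b\in p^3\mathbb{Z}_p$. -/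

import Mathlib

open Filter Topology

namespace PadicGamma

/-- The values at natural numbers: `(-1) ^ n * ∏ j`, the product over all `j < n` that are
prime to `p` (the index `j = 0` is divisible by `p`, so it does not contribute).
At `n = 0` the value is `1`. -/
def gammaNat (p n : ℕ) : ℤ :=
  (-1) ^ n * ∏ j ∈ (Finset.range n).filter (fun j => ¬ p ∣ j), (j : ℤ)

/-- Morita's `p`-adic Gamma function on `ℤ_[p]`: the limit of `gammaNat p n` as the natural
number `n` tends `p`-adically to `x`. The limit exists for odd `p`,
see `tendsto_gammaNat`. -/
noncomputable def padicGamma (p : ℕ) [Fact p.Prime] (x : ℤ_[p]) : ℤ_[p] :=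
  limUnder (comap (Nat.cast : ℕ → ℤ_[p]) (𝓝 x)) (fun n => (gammaNat p n : ℤ_[p]))

/-- The product of all units of `ℤ / p ^ k` is `-1`. -/
theorem prod_units_zmod (p k : ℕ) [hp : Fact p.Prime] (hp2 : p ≠ 2) [NeZero (p ^ k)] :
    ∏ u : (ZMod (p ^ k))ˣ, u = -1 := by
  classical
  have key : ∀ u : (ZMod (p ^ k))ˣ, u = u⁻¹ → u ≠ -1 → u = 1 := by
    intro u hu hu1
    have h1 : (u : ZMod (p ^ k)) * u = 1 := by
      rw [← Units.val_mul]
      nth_rewrite 2 [hu]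
      simp
    set a : ℕ := (u : ZMod (p ^ k)).val with ha
    have hau : ((a : ℤ) : ZMod (p ^ k)) = u := by simp [ha]
    have hd : ((p ^ k : ℕ) : ℤ) ∣ ((a : ℤ) - 1) * (a + 1) := by
      rw [← ZMod.intCast_zmod_eq_zero_iff_dvd]
      push_cast at hau ⊢
      rw [hau]
      linear_combination h1
    have hodd : IsCoprime (p : ℤ) 2 := by
      have := (Nat.coprime_primes hp.out Nat.prime_two).2 hp2
      exact_mod_cast Nat.isCoprime_iff_coprime.2 this
    have hpp : Prime (p : ℤ) := Nat.prime_iff_prime_int.1 hp.out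
    push_cast at hd
    by_cases h : (p : ℤ) ∣ (a : ℤ) + 1
    · have h' : ¬ (p : ℤ) ∣ (a : ℤ) - 1 := by
        intro h'
        have h2 : (p : ℤ) ∣ 2 := by
          have := dvd_sub h h'
          ring_nf at this
          exact this
        exact hpp.not_isUnit (hodd.isUnit_of_dvd' dvd_rfl h2)
      exfalso
      apply hu1
      have hc : IsCoprime ((p : ℤ) ^ k) ((a : ℤ) - 1) :=
        ((Prime.coprime_iff_not_dvd hpp).2 h').pow_left
      have h3 := hc.dvd_of_dvd_mul_left hd
      have h4 : (((a : ℤ) + 1 : ℤ) : ZMod (p ^ k)) = 0 := by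
        rw [ZMod.intCast_zmod_eq_zero_iff_dvd]
        exact_mod_cast h3
      ext
      push_cast at h4 hau ⊢
      rw [← hau]
      linear_combination h4
    · have hc : IsCoprime ((p : ℤ) ^ k) ((a : ℤ) + 1) :=
        ((Prime.coprime_iff_not_dvd hpp).2 h).pow_left
      have h3 := hc.dvd_of_dvd_mul_right hd
      have h4 : (((a : ℤ) - 1 : ℤ) : ZMod (p ^ k)) = 0 := by
        rw [ZMod.intCast_zmod_eq_zero_iff_dvd]
        exact_mod_cast h3
      ext
      push_cast at h4 hau ⊢
      rw [← hau]
      linear_combination h4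
  have h : ∏ x ∈ (Finset.univ : Finset (ZMod (p ^ k))ˣ).erase (-1), x = 1 := by
    refine Finset.prod_involution (fun x _ => x⁻¹) (by simp) ?_ ?_ (by simp)
    · intro u hu hu1 he
      exact hu1 (key u he.symm (by simpa using hu))
    · intro u hu
      simp only [Finset.mem_erase, Finset.mem_univ, and_true, ne_eq] at hu ⊢
      intro h
      apply hu
      rw [← inv_inv u, h]
      simp
  rw [← Finset.insert_erase (Finset.mem_univ (-1 : (ZMod (p ^ k))ˣ)),
    Finset.prod_insert (Finset.notMem_erase _ _), h, mul_one]

/-- `gammaNat p` has period `p ^ k` modulo `p ^ k`. -/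
theorem gammaNat_add_pow (p k n : ℕ) [hp : Fact p.Prime] (hp2 : p ≠ 2) :
    (gammaNat p (n + p ^ k) : ZMod (p ^ k)) = gammaNat p n := by
  classical
  rcases Nat.eq_zero_or_pos k with rfl | hk
  · have : Subsingleton (ZMod (p ^ 0)) := by rw [pow_zero]; infer_instance
    exact Subsingleton.elim _ _
  have : NeZero (p ^ k) := ⟨pow_ne_zero _ hp.out.ne_zero⟩
  let f : ZMod (p ^ k) → ZMod (p ^ k) := fun z => if IsUnit z then z else 1
  have hf : ∀ j : ℕ, (if ¬ p ∣ j then (j : ZMod (p ^ k)) else 1) = f j := by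
    intro j
    have : IsUnit (j : ZMod (p ^ k)) ↔ ¬ p ∣ j := by
      rw [ZMod.isUnit_iff_coprime, Nat.coprime_pow_right_iff hk, Nat.coprime_comm,
        hp.out.coprime_iff_not_dvd]
    simp only [f, this]
  have hg : ∀ m : ℕ, (gammaNat p m : ZMod (p ^ k)) =
      (-1) ^ m * ∏ j ∈ Finset.range m, f j := by
    intro m
    simp only [gammaNat, Finset.prod_filter]
    push_cast
    congr 1
    refine Finset.prod_congr rfl fun j _ => ?_
    rw [← hf j]
  have hblock : ∀ m : ℕ, ∏ j ∈ Finset.Ico m (m + p ^ k), f j = -1 := by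
    intro m
    have h1 : ∏ j ∈ Finset.Ico m (m + p ^ k), f j = ∏ z : ZMod (p ^ k), f z := by
      refine Finset.prod_nbij (fun j : ℕ => (j : ZMod (p ^ k))) (by simp) ?_ ?_ (by simp)
      · intro a ha b hb hab
        simp only [Finset.coe_Ico, Set.mem_Ico] at ha hb
        have hab' : a ≡ b [MOD p ^ k] := (ZMod.natCast_eq_natCast_iff _ _ _).1 hab
        have := Nat.ModEq.eq_of_abs_lt hab' (by rw [abs_lt]; omega)
        exact this
      · have hinj : Set.InjOn (fun j : ℕ => (j : ZMod (p ^ k)))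
            (Finset.Ico m (m + p ^ k)) := by
          intro a ha b hb hab
          simp only [Finset.coe_Ico, Set.mem_Ico] at ha hb
          have hab' : a ≡ b [MOD p ^ k] := (ZMod.natCast_eq_natCast_iff _ _ _).1 hab
          exact Nat.ModEq.eq_of_abs_lt hab' (by rw [abs_lt]; omega)
        exact Finset.surjOn_of_injOn_of_card_le _ (by simp [Set.MapsTo]) hinj (by simp [ZMod.card])
    rw [h1, ← Finset.prod_filter, ← Units.val_one, ← Units.val_neg,
      ← prod_units_zmod p k hp2, Units.coe_prod]
    symm
    refine Finset.prod_nbij (fun u : (ZMod (p ^ k))ˣ => (u : ZMod (p ^ k))) (by simp) ?_ ?_ (by simp)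
    · intro a _ b _ hab
      exact Units.ext hab
    · intro z hz
      simp only [Finset.coe_filter, Finset.mem_univ, true_and, Set.mem_ofPred_eq] at hz
      exact ⟨hz.unit, by simp, rfl⟩
  have hodd : Odd (p ^ k) := (hp.out.odd_of_ne_two hp2).pow
  rw [hg, hg, ← Finset.prod_range_mul_prod_Ico _ (Nat.le_add_right n (p ^ k)), hblock,
    pow_add, hodd.neg_one_pow]
  ring

/-- `gammaNat p` preserves congruences modulo `p ^ k`. -/
theorem gammaNat_congr (p k : ℕ) [hp : Fact p.Prime] (hp2 : p ≠ 2) {a b : ℕ}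
    (h : a ≡ b [MOD p ^ k]) : (gammaNat p a : ZMod (p ^ k)) = gammaNat p b := by
  have hmul : ∀ n t : ℕ, (gammaNat p (n + p ^ k * t) : ZMod (p ^ k)) = gammaNat p n := by
    intro n t
    induction t with
    | zero => simp
    | succ t ih => rw [Nat.mul_succ, ← add_assoc, gammaNat_add_pow p k _ hp2, ih]
  rw [← Nat.mod_add_div a (p ^ k), ← Nat.mod_add_div b (p ^ k), hmul, hmul, h]

/-- For odd `p` the limit that defines `padicGamma p x` exists, for every `x`. -/
theorem tendsto_gammaNat (p : ℕ) [hp : Fact p.Prime] (hp2 : p ≠ 2) (x : ℤ_[p]) :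
    Tendsto (fun n => (gammaNat p n : ℤ_[p])) (comap (Nat.cast : ℕ → ℤ_[p]) (𝓝 x))
      (𝓝 (padicGamma p x)) := by
  have hne : NeBot (comap (Nat.cast : ℕ → ℤ_[p]) (𝓝 x)) :=
    comap_neBot_iff.2 fun _ hs => PadicInt.denseRange_natCast.mem_nhds hs
  have hC : Cauchy (map (fun n => (gammaNat p n : ℤ_[p]))
      (comap (Nat.cast : ℕ → ℤ_[p]) (𝓝 x))) := by
    rw [Metric.cauchy_iff]
    refine ⟨hne.map _, fun ε hε => ?_⟩
    obtain ⟨k, hk⟩ := PadicInt.exists_pow_neg_lt p hε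
    refine ⟨(fun n => (gammaNat p n : ℤ_[p])) ''
      ((Nat.cast : ℕ → ℤ_[p]) ⁻¹' Metric.ball x ((p : ℝ) ^ (-(k : ℤ)))),
      image_mem_map (preimage_mem_comap (Metric.ball_mem_nhds _ ?_)), ?_⟩
    · have := hp.out.pos
      positivity
    · rintro _ ⟨a, ha, rfl⟩ _ ⟨b, hb, rfl⟩
      simp only [Set.mem_preimage, Metric.mem_ball] at ha hb
      have hmod : a ≡ b [MOD p ^ k] := by
        have h1 : dist (a : ℤ_[p]) (b : ℤ_[p]) ≤ (p : ℝ) ^ (-(k : ℤ)) := by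
          rw [dist_eq_norm, show (a : ℤ_[p]) - b = (a - x) + (x - b) by ring]
          refine (PadicInt.nonarchimedean _ _).trans (max_le ?_ ?_)
          · rw [← dist_eq_norm]; exact ha.le
          · rw [← dist_eq_norm, dist_comm]; exact hb.le
        rw [dist_eq_norm, PadicInt.norm_le_pow_iff_mem_span_pow, ← PadicInt.ker_toZModPow,
          RingHom.mem_ker, map_sub, map_natCast, map_natCast, sub_eq_zero] at h1
        exact (ZMod.natCast_eq_natCast_iff _ _ _).1 h1
      refine lt_of_le_of_lt ?_ hk
      rw [dist_eq_norm, PadicInt.norm_le_pow_iff_mem_span_pow, ← PadicInt.ker_toZModPow,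
        RingHom.mem_ker, map_sub, map_intCast, map_intCast, sub_eq_zero]
      exact gammaNat_congr p k hp2 hmod
  obtain ⟨y, hy⟩ := CompleteSpace.complete hC
  exact tendsto_nhds_limUnder ⟨y, hy⟩

/-- `3/4` is a `p`-adic integer for odd `p`. -/
theorem norm_three_fourths_le (p : ℕ) [hp : Fact p.Prime] (hp2 : p ≠ 2) :
    ‖(3 / 4 : ℚ_[p])‖ ≤ 1 := by
  have h4 : ‖((4 : ℕ) : ℚ_[p])‖ = 1 := by
    rw [Padic.norm_natCast_eq_one_iff]
    have := (Nat.coprime_primes hp.out Nat.prime_two).2 hp2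
    exact Nat.Coprime.pow_right 2 this
  have h3 : ‖((3 : ℕ) : ℚ_[p])‖ ≤ 1 := by
    exact_mod_cast Padic.norm_int_le_one (p := p) 3
  rw [norm_div]
  push_cast at h4 h3
  rw [h4, div_one]
  exact h3

/-- The `p`-adic integer `3/4`, for odd `p`. -/
noncomputable def threeFourths (p : ℕ) [Fact p.Prime] (hp2 : p ≠ 2) : ℤ_[p] :=
  ⟨(3 / 4 : ℚ_[p]), norm_three_fourths_le p hp2⟩

/-- Congruence modulo `p ^ m` of elements of `ℚ_[p]`: the difference lies in `p ^ m ℤ_[p]`. -/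
def CongrModPow (p : ℕ) [Fact p.Prime] (m : ℕ) (a b : ℚ_[p]) : Prop :=
  ∃ c : ℤ_[p], a - b = (p : ℚ_[p]) ^ m * (c : ℚ_[p])

/-- The truncated sum `∑ (4 k + 1) * (-1/2 choose k) ^ 5` over `0 ≤ k ≤ (p - 1) / 2`. -/
noncomputable def truncatedSum (p : ℕ) : ℚ :=
  ∑ k ∈ Finset.range ((p - 1) / 2 + 1), (4 * (k : ℚ) + 1) * Ring.choose (-1 / 2 : ℚ) k ^ 5

end PadicGamma

/-!
The summand is `(4 k + 1) * ∏ i < k, -c_i ^ 5` with `c_i = (i + 1/2) / (i + 1)`. Write `p = 2 n + 1` and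
`x = p / 2 = n + 1/2`. Replacing `c_i ^ 4` by

  `((i + 1/2)² - x²) ((i + 1/2)² - Y) / (((i + 1)² - x²) ((i + 1)² - Y))`

turns the sum into a very-well-poised `₆F₅(-1)` that terminates at `k = n`. For `Y = -x²` this
quotient is `((i + 1/2)⁴ - x⁴) / ((i + 1)⁴ - x⁴)`, so the truncated sum changes only by a multiple of
`p ^ 3`. Whipple's transformation (`sum_wellPoisedCoeff_mul_prod_div`) evaluates the deformed sum as
`(2 n + 1) (-1) ^ n` times a `₃F₂`. Since `2 n + 1 = p`, that `₃F₂` matters only modulo `p ^ 2`, where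
`Y` may be replaced by `0`. This gives `truncatedSum_congrModPow`:
the sum is congruent to `p (-1) ^ n ₃F₂(1/2, -n, n + 1; 1, 1; 1)`.

Whipple's transformation is obtained by expanding the `Y`-dependent factor by a Pfaff–Saalschütz sum
(`sum_saalschutz`) and interchanging the sums. The inner sums are `sum_wellPoisedCoeff_mul_prod`.
The remaining `₃F₂` is `P_n(0) ^ 2` for the Legendre polynomial `P_n`: it vanishes for odd `n`, which
settles `p ≡ 3 mod 4`, and it equals `((1/2)_m / m!) ^ 2` for `n = 2 m`
(`legendreSum_odd`, `legendreSum_even`).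

For `p = 4 m + 1` it remains to see that `((1/2)_m) ^ 2 Γ_p(3/4) ^ 4 ≡ -(m!) ^ 2` modulo `p ^ 2`
(`sq_prod_mul_gammaNat_pow_four`). Here `Γ_p(3/4)` may be replaced by the value at the natural number
`m p + m + 1`, which is up to sign `(p - 1)! ^ m ∏_{1 ≤ j ≤ m} (m p + j)`. Modulo `p ^ 2` one has
`(m p + j)² = j (j - p/2)`; pairing `j` with `p - j` gives
`(p - 1)! = ((1/2)_m) ^ 2 ∏_{1 ≤ j ≤ m} (j - p/2)²`; and the powers of `(p - 1)!` collect to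
`(p - 1)! ^ p = -1`.
-/

namespace PadicGamma

/-! ### Terminating hypergeometric identities -/

section Identities

open Finset

variable {K : Type*} [Field K]

theorem add_half_ne_zero [CharZero K] (i : ℕ) : (i : K) + 1 / 2 ≠ 0 := fun h => by
  have h2 : ((2 * i + 1 : ℕ) : K) = 0 := by push_cast; linear_combination 2 * h
  exact Nat.cast_ne_zero.2 (by omega) h2

theorem add_one_sq_sub_half_sq_ne_zero [CharZero K] (n i : ℕ) :
    ((i : K) + 1) ^ 2 - (n + 1 / 2) ^ 2 ≠ 0 := fun h => by
  have h1 : (((2 * i + 2) ^ 2 : ℕ) : K) = ((2 * n + 1) ^ 2 : ℕ) := by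
    push_cast; linear_combination 4 * h
  have h2 := Nat.pow_left_injective (n := 2) (by norm_num) (Nat.cast_injective h1)
  omega

/-- The case of the Pfaff–Saalschütz sum that expands the quotient on the right in the Newton basis
`∏ i < j, (i - k) * (i + k + 1 / 2)` of polynomials in `k * (k + 1 / 2)`. With `j` as summation
index, the first-order recurrence in `k` satisfied by both sides telescopes. -/
theorem sum_saalschutz [CharZero K] (Y : K) (hY : ∀ i : ℕ, ((i : K) + 1) ^ 2 - Y ≠ 0) (k : ℕ) :
    ∑ j ∈ range (k + 1), ∏ i ∈ range j,
      ((i : K) + 1 / 2) * (i - k) * (i + k + 1 / 2) / ((i + 1) * ((i + 1) ^ 2 - Y)) =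
    ∏ i ∈ range k, (((i : K) + 1 / 2) ^ 2 - Y) / ((i + 1) ^ 2 - Y) := by
  have hi : ∀ i : ℕ, (i : K) + 1 ≠ 0 := fun i => Nat.cast_add_one_ne_zero i
  obtain ⟨s, hs⟩ : ∃ s : ℕ → ℕ → K, ∀ k j, s k j = ∏ i ∈ range j,
    ((i : K) + 1 / 2) * (i - k) * (i + k + 1 / 2) / ((i + 1) * ((i + 1) ^ 2 - Y)) :=
    ⟨_, fun _ _ => rfl⟩
  have hs0 : ∀ k, s k 0 = 1 := fun k => by simp [hs]
  have hsS : ∀ k j, s k (j + 1) = s k j *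
      (((j : K) + 1 / 2) * (j - k) * (j + k + 1 / 2) / ((j + 1) * ((j + 1) ^ 2 - Y))) := by
    intro k j
    simp only [hs, prod_range_succ]
  simp only [← hs]
  induction k with
  | zero => simp [hs0]
  | succ k ih =>
    -- `t j` is, up to a factor free of `j`, the common part of the terms `s k j` and `s (k + 1) j`
    obtain ⟨t, ht⟩ : ∃ t : ℕ → K, ∀ j, t j = ∏ i ∈ range j,
        ((i : K) + 1 / 2) * (i - k - 1) * (i + k + 1 / 2) / ((i + 1) * ((i + 1) ^ 2 - Y)) :=
      ⟨_, fun _ => rfl⟩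
    have ht0 : t 0 = 1 := by simp [ht]
    have htS : ∀ j, t (j + 1) = t j *
        (((j : K) + 1 / 2) * (j - k - 1) * (j + k + 1 / 2) / ((j + 1) * ((j + 1) ^ 2 - Y))) := by
      intro j
      simp only [ht, prod_range_succ]
    have hst : ∀ j, s k j * (k + 1) = t j * (k + 1 - j) := by
      intro j
      induction j with
      | zero => simp [hs0, ht0]
      | succ j ihj =>
        have := hi j
        have := hY j
        rw [hsS, htS, mul_right_comm, ihj]
        push_cast
        field_simp
        ring
    have hst' : ∀ j, s (k + 1) j * (k + 1 / 2) = t j * (k + j + 1 / 2) := by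
      intro j
      induction j with
      | zero => simp [hs0, ht0]
      | succ j ihj =>
        have := hi j
        have := hY j
        rw [hsS, htS, mul_right_comm, ihj]
        push_cast
        field_simp
        ring
    -- the Gosper certificate of the telescoping sum
    obtain ⟨H, hH⟩ : ∃ H : ℕ → K, ∀ j, H j = -(2 * k + 3 / 2) * t j * j * (j ^ 2 - Y) :=
      ⟨_, fun _ => rfl⟩
    have hstep : ∀ j, (((k : K) + 1) ^ 2 - Y) * (k + 1) * (s (k + 1) j * (k + 1 / 2)) -
        ((k + 1 / 2) ^ 2 - Y) * (k + 1 / 2) * (s k j * (k + 1)) = H (j + 1) - H j := by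
      intro j
      have h1 : t (j + 1) * ((j + 1) * ((j + 1) ^ 2 - Y)) =
          t j * ((j + 1 / 2) * (j - k - 1) * (j + k + 1 / 2)) := by
        have := hi j
        have := hY j
        rw [htS]
        field_simp
      rw [hst, hst', hH, hH]
      push_cast
      linear_combination (2 * (k : K) + 3 / 2) * h1
    have htel := sum_range_sub H (k + 2)
    have hH0 : H 0 = 0 := by simp [hH]
    have hHk : H (k + 2) = 0 := by
      rw [hH, htS (k + 1)]
      push_cast
      ring
    rw [hH0, hHk, sub_zero, ← sum_congr rfl fun j _ => hstep j, sum_sub_distrib, ← mul_sum,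
      ← mul_sum, ← sum_mul, ← sum_mul, sub_eq_zero] at htel
    have hlast : ∑ j ∈ range (k + 2), s k j = ∑ j ∈ range (k + 1), s k j := by
      rw [sum_range_succ, hsS k k]
      simp
    rw [hlast, ih] at htel
    rw [prod_range_succ]
    apply mul_left_cancel₀ (mul_ne_zero (mul_ne_zero (hi k) (add_half_ne_zero k)) (hY k))
    rw [show k + 1 + 1 = k + 2 from rfl]
    have h7 : ∀ P : K, ((k : K) + 1) * (k + 1 / 2) * ((k + 1) ^ 2 - Y) *
        (P * (((k + 1 / 2) ^ 2 - Y) / ((k + 1) ^ 2 - Y))) =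
        (k + 1) * (k + 1 / 2) * ((k + 1 / 2) ^ 2 - Y) * P := by
      intro P
      have := hY k
      field_simp
    rw [h7]
    linear_combination htel

/-- The coefficient `(4 k + 1) (-1) ^ k (1/2)_k / k! * ∏_{1 ≤ i ≤ k} ((i - 1/2)² - x²) / (i² - x²)`
of a very-well-poised series with `a = 1/2`. The index is shifted to run over `i < k`, and the
sign `(-1) ^ k` is distributed over the factors. -/
def wellPoisedCoeff (x : K) (k : ℕ) : K :=
  (4 * k + 1) * ∏ i ∈ range k,
    -(((i : K) + 1 / 2) / (i + 1) * (((i + 1 / 2) ^ 2 - x ^ 2) / ((i + 1) ^ 2 - x ^ 2)))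

/-- For `x = n + 1 / 2` the linear functional `f ↦ ∑ k, wellPoisedCoeff x k * f k` takes values on
the Newton basis that satisfy a first-order recurrence in `j`, because the difference of the two
sides telescopes in `k`. -/
theorem sum_wellPoisedCoeff_step [CharZero K] (n j : ℕ) :
    ∑ k ∈ range (n + 1), wellPoisedCoeff ((n : K) + 1 / 2) k *
        ∏ i ∈ range (j + 1), ((i : K) - k) * (i + k + 1 / 2) =
      ((j : K) - n) * (j + n + 1) * ∑ k ∈ range (n + 1), wellPoisedCoeff ((n : K) + 1 / 2) k *
        ∏ i ∈ range j, ((i : K) - k) * (i + k + 1 / 2) := by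
  have hi : ∀ i : ℕ, (i : K) + 1 ≠ 0 := fun i => Nat.cast_add_one_ne_zero i
  have hx := add_one_sq_sub_half_sq_ne_zero (K := K) n
  obtain ⟨v, hv⟩ : ∃ v : ℕ → K, ∀ k, v k = ∏ i ∈ range k, -(((i : K) + 1 / 2) / (i + 1) *
    (((i + 1 / 2) ^ 2 - ((n : K) + 1 / 2) ^ 2) / ((i + 1) ^ 2 - ((n : K) + 1 / 2) ^ 2))) :=
    ⟨_, fun _ => rfl⟩
  have hvS : ∀ k, v (k + 1) * ((k + 1) * ((k + 1) ^ 2 - ((n : K) + 1 / 2) ^ 2)) =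
      - (v k * ((k + 1 / 2) * ((k + 1 / 2) ^ 2 - ((n : K) + 1 / 2) ^ 2))) := by
    intro k
    have h1 := hi k
    have h2 := hx k
    have h3 := prod_range_succ (fun i : ℕ => -(((i : K) + 1 / 2) / (i + 1) *
      (((i + 1 / 2) ^ 2 - ((n : K) + 1 / 2) ^ 2) / ((i + 1) ^ 2 - ((n : K) + 1 / 2) ^ 2)))) k
    rw [← hv, ← hv] at h3
    rw [h3]
    clear hv h3
    generalize (n : K) + 1 / 2 = x at *
    field_simp
  have hw : ∀ k, wellPoisedCoeff ((n : K) + 1 / 2) k = (4 * k + 1) * v k := fun k => by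
    rw [hv, wellPoisedCoeff]
  simp only [hw]
  clear hv hw
  obtain ⟨g, hg⟩ : ∃ g : ℕ → ℕ → K, ∀ j k, g j k = ∏ i ∈ range j, ((i : K) - k) * (i + k + 1 / 2) :=
    ⟨_, fun _ _ => rfl⟩
  have hg0 : ∀ k, g 0 k = 1 := fun k => by simp [hg]
  have hgS : ∀ j k, g (j + 1) k = g j k * (((j : K) - k) * (j + k + 1 / 2)) := fun j k => by
    simp only [hg, prod_range_succ]
  have hgk : ∀ k, g j (k + 1) * ((k + 1 - j) * (k + 1 / 2)) =
      g j k * ((k + 1) * (k + j + 1 / 2)) := by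
    intro k
    induction j with
    | zero => simp [hg0]
    | succ j ihj =>
      rw [hgS, hgS]
      push_cast at ihj ⊢
      linear_combination ((j : K) - k) * (j + k + 3 / 2) * ihj
  simp only [← hg, hgS]
  -- the Gosper certificate of the telescoping sum
  obtain ⟨H, hH⟩ : ∃ H : ℕ → K, ∀ k, H k =
      2 * v k * g j k * (k - j) * (k ^ 2 - ((n : K) + 1 / 2) ^ 2) := ⟨_, fun _ => rfl⟩
  have htel := sum_range_sub H (n + 1)
  have hstep : ∀ k : ℕ, (4 * (k : K) + 1) * v k * (g j k * (((j : K) - k) * (j + k + 1 / 2))) -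
      ((j : K) - n) * (j + n + 1) * ((4 * (k : K) + 1) * v k * g j k) = H (k + 1) - H k := by
    intro k
    rw [hH, hH]
    apply mul_left_cancel₀ (mul_ne_zero (hi k) (add_half_ne_zero k))
    push_cast
    linear_combination
      (-2 * g j (k + 1) * (k + 1 - j) * (k + 1 / 2)) * hvS k +
      (2 * v k * ((k + 1 / 2) * ((k + 1 / 2) ^ 2 - ((n : K) + 1 / 2) ^ 2))) * hgk k
  have hH0 : H 0 = 0 := by
    rw [hH]
    rcases j with _ | j
    · simp
    · rw [hg, prod_eq_zero (mem_range.2 j.succ_pos) (by simp)]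
      simp
  have hHn : H (n + 1) = 0 := by
    have hvn : v (n + 1) = 0 := by
      have := hvS n
      rw [sub_self, mul_zero, mul_zero, neg_zero] at this
      exact (mul_eq_zero.1 this).resolve_right (mul_ne_zero (hi n) (hx n))
    rw [hH, hvn]
    simp
  rw [hH0, hHn, sub_zero, ← sum_congr rfl fun j _ => hstep j, sum_sub_distrib, ← mul_sum,
    sub_eq_zero] at htel
  exact htel

theorem prod_range_add_sub (c : K) (n : ℕ) :
    ∏ i ∈ range n, ((i : K) + c - n) = (-1) ^ n * ∏ i ∈ range n, ((i : K) + 1 - c) := by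
  rw [← prod_range_reflect, show (-1 : K) ^ n = ∏ _i ∈ range n, (-1 : K) by simp,
    ← prod_mul_distrib]
  refine prod_congr rfl fun i hi => ?_
  have := mem_range.1 hi
  rw [Nat.cast_sub (by omega), Nat.cast_sub (by omega)]
  push_cast
  ring

/-- The value of the functional on the Newton basis element with `j = n`, where `k = n` gives the
only nonzero term. -/
theorem wellPoisedCoeff_self_mul_prod [CharZero K] (n : ℕ) :
    wellPoisedCoeff ((n : K) + 1 / 2) n * ∏ i ∈ range n, ((i : K) - n) * (i + n + 1 / 2) =
      (2 * n + 1) * (-1) ^ n * ∏ i ∈ range n, ((i : K) - n) * (i + n + 1) := by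
  have hx := add_one_sq_sub_half_sq_ne_zero (K := K) n
  have h1 : ∏ i ∈ range n, ((i : K) - n) = (-1) ^ n * ∏ i ∈ range n, ((i : K) + 1) := by
    simpa using prod_range_add_sub (0 : K) n
  have h2 : ∏ i ∈ range n, ((i : K) + 1 / 2 - n) = (-1) ^ n * ∏ i ∈ range n, ((i : K) + 1 / 2) := by
    rw [prod_range_add_sub]
    exact congrArg _ (prod_congr rfl fun i _ => by ring)
  have h3 : (4 * (n : K) + 1) * ∏ i ∈ range n, ((i : K) + n + 1 / 2) =
      (2 * n + 1) * ∏ i ∈ range n, ((i : K) + n + 3 / 2) := by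
    have h4 := prod_range_succ (fun i : ℕ => (i : K) + n + 1 / 2) n
    rw [prod_range_succ'] at h4
    have h5 : ∏ i ∈ range n, (((i + 1 : ℕ) : K) + n + 1 / 2) =
        ∏ i ∈ range n, ((i : K) + n + 3 / 2) :=
      prod_congr rfl fun i _ => by push_cast; ring
    rw [h5] at h4
    push_cast at h4
    linear_combination (-2) * h4
  have h6 : ∏ i ∈ range n, (((i : K) + 1) ^ 2 - (n + 1 / 2) ^ 2) =
      (∏ i ∈ range n, ((i : K) + 1 / 2 - n)) * ∏ i ∈ range n, ((i : K) + n + 3 / 2) := by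
    rw [← prod_mul_distrib]
    exact prod_congr rfl fun i _ => by ring
  have h7 : ∏ i ∈ range n, (((i : K) + 1 / 2) ^ 2 - (n + 1 / 2) ^ 2) =
      (∏ i ∈ range n, ((i : K) - n)) * ∏ i ∈ range n, ((i : K) + n + 1) := by
    rw [← prod_mul_distrib]
    exact prod_congr rfl fun i _ => by ring
  have hF : ∏ i ∈ range n, ((i : K) + 1) ≠ 0 :=
    prod_ne_zero_iff.2 fun i _ => Nat.cast_add_one_ne_zero i
  have hA : ∏ i ∈ range n, ((i : K) + 1 / 2) ≠ 0 :=
    prod_ne_zero_iff.2 fun i _ => add_half_ne_zero i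
  have hB : ∏ i ∈ range n, (((i : K) + 1) ^ 2 - (n + 1 / 2) ^ 2) ≠ 0 :=
    prod_ne_zero_iff.2 fun i _ => hx i
  have hs : ((-1 : K) ^ n) ^ 2 = 1 := by rw [← pow_mul, mul_comm, pow_mul]; simp
  rw [h6, h2] at hB
  have hC := right_ne_zero_of_mul hB
  rw [wellPoisedCoeff, prod_neg, card_range]
  simp only [prod_mul_distrib, prod_div_distrib]
  rw [h7, h6, h1, h2]
  generalize ∏ i ∈ range n, ((i : K) + 1) = F at *
  generalize ∏ i ∈ range n, ((i : K) + 1 / 2) = A at *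
  generalize ∏ i ∈ range n, ((i : K) + n + 3 / 2) = C at *
  generalize ∏ i ∈ range n, ((i : K) + n + 1 / 2) = E at *
  generalize ∏ i ∈ range n, ((i : K) + n + 1) = L at *
  have hs0 : (-1 : K) ^ n ≠ 0 := by simp
  generalize (-1 : K) ^ n = e at *
  have h8 : (2 * (n : K) + 1) = (4 * n + 1) * E / C := by
    rw [h3]
    field_simp
  rw [h8]
  field_simp

/-- The value of the functional on every Newton basis element with `j ≤ n`. The recurrence is run
downwards from `j = n`, since its factor `j - n` is nonzero for `j < n` and vanishes at `j = n`. -/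
theorem sum_wellPoisedCoeff_mul_prod [CharZero K] {n j : ℕ} (hj : j ≤ n) :
    ∑ k ∈ range (n + 1), wellPoisedCoeff ((n : K) + 1 / 2) k *
        ∏ i ∈ range j, ((i : K) - k) * (i + k + 1 / 2) =
      (2 * n + 1) * (-1) ^ n * ∏ i ∈ range j, ((i : K) - n) * (i + n + 1) := by
  refine Nat.decreasingInduction (motive := fun j _ => ∑ k ∈ range (n + 1),
    wellPoisedCoeff ((n : K) + 1 / 2) k * ∏ i ∈ range j, ((i : K) - k) * (i + k + 1 / 2) =
      (2 * n + 1) * (-1) ^ n * ∏ i ∈ range j, ((i : K) - n) * (i + n + 1)) ?_ ?_ hj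
  · intro j hjn ih
    have h1 : (j : K) - n ≠ 0 := sub_ne_zero.2 (Nat.cast_injective.ne hjn.ne)
    have h2 : (j : K) + n + 1 ≠ 0 := by exact_mod_cast Nat.succ_ne_zero (j + n)
    rw [sum_wellPoisedCoeff_step, prod_range_succ] at ih
    apply mul_left_cancel₀ (mul_ne_zero h1 h2)
    rw [ih]
    ring
  · rw [← wellPoisedCoeff_self_mul_prod]
    refine sum_eq_single_of_mem n (self_mem_range_succ n) fun k hk hkn => ?_
    have : k < n := by have := mem_range.1 hk; omega
    rw [prod_eq_zero (mem_range.2 this) (by simp), mul_zero]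

/-- Whipple's transformation of a terminating very-well-poised `₆F₅(-1)` into a `₃F₂(1)`, for
`a = 1/2` and parameter pairs `-n, n + 1` and `1/2 ± √Y`. Only the square `Y` of the free parameter
enters, so it may be negative. -/
theorem sum_wellPoisedCoeff_mul_prod_div [CharZero K] (n : ℕ) (Y : K)
    (hY : ∀ i : ℕ, ((i : K) + 1) ^ 2 - Y ≠ 0) :
    ∑ k ∈ range (n + 1), wellPoisedCoeff ((n : K) + 1 / 2) k *
        ∏ i ∈ range k, (((i : K) + 1 / 2) ^ 2 - Y) / ((i + 1) ^ 2 - Y) =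
      (2 * n + 1) * (-1) ^ n * ∑ j ∈ range (n + 1), ∏ i ∈ range j,
        ((i : K) + 1 / 2) * (i - n) * (i + n + 1) / ((i + 1) * ((i + 1) ^ 2 - Y)) := by
  have h1 : ∀ k ∈ range (n + 1), ∏ i ∈ range k, (((i : K) + 1 / 2) ^ 2 - Y) / ((i + 1) ^ 2 - Y) =
      ∑ j ∈ range (n + 1), (∏ i ∈ range j, ((i : K) + 1 / 2) / ((i + 1) * ((i + 1) ^ 2 - Y))) *
        ∏ i ∈ range j, ((i : K) - k) * (i + k + 1 / 2) := by
    intro k hk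
    rw [← sum_saalschutz Y hY k]
    have h2 : ∀ j, ∏ i ∈ range j,
        ((i : K) + 1 / 2) * (i - k) * (i + k + 1 / 2) / ((i + 1) * ((i + 1) ^ 2 - Y)) =
        (∏ i ∈ range j, ((i : K) + 1 / 2) / ((i + 1) * ((i + 1) ^ 2 - Y))) *
          ∏ i ∈ range j, ((i : K) - k) * (i + k + 1 / 2) := fun j => by
      rw [← prod_mul_distrib]
      exact prod_congr rfl fun i _ => by ring
    simp only [h2]
    refine sum_subset (range_subset_range.2 (by have := mem_range.1 hk; omega)) fun j _ hj => ?_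
    have : k < j := by have := mt mem_range.2 hj; omega
    rw [prod_eq_zero (f := fun i : ℕ => ((i : K) - k) * (i + k + 1 / 2)) (mem_range.2 this)
      (by simp), mul_zero]
  rw [sum_congr rfl fun k hk => congrArg _ (h1 k hk)]
  simp only [mul_sum]
  rw [sum_comm]
  refine sum_congr rfl fun j hj => ?_
  have h3 := sum_wellPoisedCoeff_mul_prod (K := K) (Nat.lt_succ_iff.1 (mem_range.1 hj))
  rw [sum_congr rfl fun k _ => mul_left_comm _ _ _, ← mul_sum, h3, mul_left_comm,
    ← prod_mul_distrib]
  exact congrArg _ (prod_congr rfl fun i _ => by ring)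

/-- The terminating series `₃F₂(1/2, -n, n + 1; 1, 1; 1)`, which is `P_n(0) ^ 2` for the Legendre
polynomial `P_n`. It is given as the sum of its terms, each written as the product of the
successive term ratios. -/
def legendreSum (K : Type*) [Field K] (n : ℕ) : K :=
  ∑ j ∈ range (n + 1), ∏ i ∈ range j, ((i : K) + 1 / 2) * (i - n) * (i + n + 1) / (i + 1) ^ 3

/-- Zeilberger's recurrence for `legendreSum`. The difference of the two sides telescopes. -/
theorem legendreSum_add_two [CharZero K] (n : ℕ) :
    ((n : K) + 2) ^ 2 * legendreSum K (n + 2) = (n + 1) ^ 2 * legendreSum K n := by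
  have hi : ∀ i : ℕ, (i : K) + 1 ≠ 0 := fun i => Nat.cast_add_one_ne_zero i
  obtain ⟨s, hs⟩ : ∃ s : ℕ → ℕ → K, ∀ n j, s n j = ∏ i ∈ range j,
    ((i : K) + 1 / 2) * (i - n) * (i + n + 1) / (i + 1) ^ 3 := ⟨_, fun _ _ => rfl⟩
  have hs0 : ∀ n, s n 0 = 1 := fun n => by simp [hs]
  have hsS : ∀ n j, s n (j + 1) = s n j *
      (((j : K) + 1 / 2) * (j - n) * (j + n + 1) / (j + 1) ^ 3) := fun n j => by
    simp only [hs, prod_range_succ]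
  simp only [legendreSum, ← hs]
  -- `t j` is, up to a factor free of `j`, the common part of the terms `s n j` and `s (n + 2) j`
  obtain ⟨t, ht0, htS⟩ : ∃ t : ℕ → K, t 0 = 1 ∧ ∀ j, t (j + 1) = t j *
      (((j : K) + 1 / 2) * (j - n - 2) * (j + n + 1) / (j + 1) ^ 3) :=
    ⟨fun j => ∏ i ∈ range j, (((i : K) + 1 / 2) * (i - n - 2) * (i + n + 1) / (i + 1) ^ 3),
      by simp, fun j => prod_range_succ _ _⟩
  have hst : ∀ j, s n j * ((n + 1) * (n + 2)) = t j * ((n + 1 - j) * (n + 2 - j)) := by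
    intro j
    induction j with
    | zero => simp [hs0, ht0]
    | succ j ihj =>
      have := hi j
      rw [hsS, htS, mul_right_comm, ihj]
      push_cast
      field_simp
      ring
  have hst' : ∀ j, s (n + 2) j * ((n + 1) * (n + 2)) = t j * ((n + 1 + j) * (n + 2 + j)) := by
    intro j
    induction j with
    | zero => simp [hs0, ht0]
    | succ j ihj =>
      have := hi j
      rw [hsS, htS, mul_right_comm, ihj]
      push_cast
      field_simp
      ring
  -- the Gosper certificate of the telescoping sum
  obtain ⟨H, hH⟩ : ∃ H : ℕ → K, ∀ j, H j = -(2 * (2 * n + 3)) * t j * j ^ 3 :=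
    ⟨_, fun _ => rfl⟩
  have hstep : ∀ j, ((n : K) + 2) ^ 2 * (s (n + 2) j * ((n + 1) * (n + 2))) -
      (n + 1) ^ 2 * (s n j * ((n + 1) * (n + 2))) = H (j + 1) - H j := by
    intro j
    have h1 : t (j + 1) * (j + 1) ^ 3 = t j * ((j + 1 / 2) * (j - n - 2) * (j + n + 1)) := by
      have := hi j
      rw [htS]
      field_simp
    rw [hst, hst', hH, hH]
    push_cast
    linear_combination (2 * (2 * (n : K) + 3)) * h1
  have htel := sum_range_sub H (n + 3)
  have hH0 : H 0 = 0 := by simp [hH]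
  have hHn : H (n + 3) = 0 := by
    rw [hH, htS (n + 2)]
    push_cast
    ring
  rw [hH0, hHn, sub_zero, ← sum_congr rfl fun j _ => hstep j, sum_sub_distrib, ← mul_sum,
    ← mul_sum, ← sum_mul, ← sum_mul, sub_eq_zero] at htel
  have hlast : ∑ j ∈ range (n + 3), s n j = ∑ j ∈ range (n + 1), s n j := by
    rw [sum_range_succ, sum_range_succ, hsS n (n + 1), hsS n n]
    simp
  rw [hlast] at htel
  have h2 : (n : K) + 2 ≠ 0 := by exact_mod_cast Nat.succ_ne_zero (n + 1)
  apply mul_right_cancel₀ (mul_ne_zero (hi n) h2)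
  rw [show n + 2 + 1 = n + 3 from rfl]
  linear_combination htel

theorem legendreSum_odd [CharZero K] (m : ℕ) : legendreSum K (2 * m + 1) = 0 := by
  induction m with
  | zero => simp [legendreSum, sum_range_succ]; norm_num
  | succ m ih =>
    have h := legendreSum_add_two (K := K) (2 * m + 1)
    rw [ih, mul_zero] at h
    refine (mul_eq_zero.1 h).resolve_left (pow_ne_zero 2 ?_)
    exact_mod_cast Nat.succ_ne_zero (2 * m + 1 + 1)

theorem legendreSum_even [CharZero K] (m : ℕ) :
    legendreSum K (2 * m) = (∏ i ∈ range m, ((i : K) + 1 / 2) / (i + 1)) ^ 2 := by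
  induction m with
  | zero => simp [legendreSum]
  | succ m ih =>
    have h := legendreSum_add_two (K := K) (2 * m)
    rw [ih] at h
    have h1 : (m : K) + 1 ≠ 0 := Nat.cast_add_one_ne_zero m
    rw [prod_range_succ, mul_add_one]
    generalize ∏ i ∈ range m, ((i : K) + 1 / 2) / (i + 1) = P at *
    push_cast at h
    field_simp
    linear_combination h

end Identities

/-! ### The Gamma value modulo `p ^ 2` as a product -/

section ModSquare

open Finset
open scoped Nat

theorem prod_range_two_mul {M : Type*} [CommMonoid M] (f : ℕ → M) (n : ℕ) :
    ∏ j ∈ range (2 * n), f j = ∏ j ∈ range n, f j * f (2 * n - 1 - j) := by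
  rw [two_mul, prod_range_add, prod_mul_distrib, ← prod_range_reflect (fun x => f (n + x))]
  refine congrArg _ (prod_congr rfl fun j hj => congrArg f ?_)
  have := mem_range.1 hj
  omega

/-- The product of a block of `p - 1` consecutive numbers that follow a multiple of `P` does not
depend on the block, modulo `P ^ 2`: the factors `a P + j` and `a P + P - j` multiply to
`j (P - j)`. -/
theorem prod_range_mul_add_succ {R : Type*} [CommRing R] {P : R} (hP : P ^ 2 = 0) {n : ℕ}
    (hn : 2 * (n : R) + 1 = P) (a : R) :
    ∏ j ∈ range (2 * n), (a * P + (j + 1)) = ∏ j ∈ range n, ((j : R) + 1) * (P - (j + 1)) := by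
  rw [prod_range_two_mul]
  refine prod_congr rfl fun j hj => ?_
  have := mem_range.1 hj
  have h : ((2 * n - 1 - j : ℕ) : R) = 2 * n - 1 - j := by
    rw [Nat.sub_sub, Nat.cast_sub (by omega)]
    push_cast
    ring
  rw [h]
  linear_combination (a ^ 2 + a) * hP + (a * P + (j + 1)) * hn

/-- The product that defines `gammaNat`, split into `m` full blocks between multiples of `p` and a
remainder. -/
theorem prod_range_filter_not_dvd {p : ℕ} (hp : 1 < p) (m : ℕ) {r : ℕ} (hr : r < p) :
    ∏ j ∈ (range (m * p + 1 + r)).filter (fun j => ¬ p ∣ j), j =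
      (∏ i ∈ range m, ∏ j ∈ range (p - 1), (i * p + (j + 1))) *
        ∏ j ∈ range r, (m * p + (j + 1)) := by
  have hstep : ∀ m r, r < p → ∏ j ∈ (range (m * p + 1 + r)).filter (fun j => ¬ p ∣ j), j =
      (∏ j ∈ (range (m * p + 1)).filter (fun j => ¬ p ∣ j), j) *
        ∏ j ∈ range r, (m * p + (j + 1)) := by
    intro m r hr
    simp only [prod_filter]
    rw [prod_range_add]
    refine congrArg _ (prod_congr rfl fun j hj => ?_)
    have hj := mem_range.1 hj
    have : ¬ p ∣ m * p + 1 + j := by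
      rw [add_assoc, Nat.dvd_add_right (dvd_mul_left p m)]
      exact fun h => absurd (Nat.le_of_dvd (by omega) h) (by omega)
    rw [if_pos this]
    ring
  rw [hstep m r hr]
  congr 1
  clear hr r
  induction m with
  | zero => simp [prod_filter]
  | succ m ih =>
    rw [prod_range_succ, ← ih, ← hstep m (p - 1) (by omega), prod_filter, prod_range_succ,
      if_neg (by simp), mul_one, ← prod_filter, show m * p + 1 + (p - 1) = (m + 1) * p by
        rw [add_mul]; omega]

/-- Raising Wilson's congruence to the `p`-th power makes it hold modulo `p ^ 2`. -/
theorem factorial_pred_pow_self (p : ℕ) [hp : Fact p.Prime] (hp2 : p ≠ 2) :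
    ((p - 1)! : ZMod (p ^ 2)) ^ p = -1 := by
  have h1 : (p : ℤ) ∣ ((p - 1)! : ℤ) - (-1) := by
    rw [← ZMod.intCast_zmod_eq_zero_iff_dvd]
    have := ZMod.wilsons_lemma p
    push_cast
    rw [this]
    ring
  have h2 := dvd_sub_pow_of_dvd_sub h1 1
  have h3 : ((((p - 1)! : ℤ) ^ p - (-1) ^ p : ℤ) : ZMod (p ^ 2)) = 0 := by
    rw [ZMod.intCast_zmod_eq_zero_iff_dvd]
    simpa using h2
  rw [(hp.out.odd_of_ne_two hp2).neg_one_pow] at h3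
  push_cast at h3
  linear_combination h3

/-- The argument `m * p + 1 + m` equals `(p ^ 2 + 3) / 4`, so it stands for `3 / 4` modulo `p ^ 2`,
and `h` stands for `1 / 2`. The exponent of `(p - 1)!` adds up to `p`, so that `(p - 1)!` drops
out. -/
theorem sq_prod_mul_gammaNat_pow_four {p m : ℕ} [hp : Fact p.Prime] (hm : p = 4 * m + 1)
    {h : ZMod (p ^ 2)} (hh : 2 * h = 1) :
    (∏ i ∈ range m, ((i : ZMod (p ^ 2)) + h)) ^ 2 * (gammaNat p (m * p + 1 + m)) ^ 4 =
      -(∏ i ∈ range m, ((i : ZMod (p ^ 2)) + 1)) ^ 2 := by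
  have hp2 : p ≠ 2 := by omega
  set P : ZMod (p ^ 2) := (p : ZMod (p ^ 2)) with hPdef
  have hP : P ^ 2 = 0 := by
    rw [hPdef, ← Nat.cast_pow, ZMod.natCast_self]
  have hmP : 4 * (m : ZMod (p ^ 2)) + 1 = P := by
    have := congrArg (Nat.cast : ℕ → ZMod (p ^ 2)) hm
    push_cast at this
    exact this.symm
  have hblock : ∀ a : ZMod (p ^ 2), ∏ j ∈ range (p - 1), (a * P + ((j : ZMod (p ^ 2)) + 1)) =
      ∏ l ∈ range (2 * m), ((l : ZMod (p ^ 2)) + 1) * (P - (l + 1)) := by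
    intro a
    rw [show p - 1 = 2 * (2 * m) by omega]
    exact prod_range_mul_add_succ hP (by push_cast; linear_combination hmP) a
  have hQ : ((p - 1)! : ZMod (p ^ 2)) =
      ∏ l ∈ range (2 * m), ((l : ZMod (p ^ 2)) + 1) * (P - (l + 1)) := by
    rw [← hblock 0, ← prod_range_add_one_eq_factorial]
    push_cast
    exact prod_congr rfl fun j _ => by ring
  have hQp := factorial_pred_pow_self p hp2
  have hG : (gammaNat p (m * p + 1 + m) : ZMod (p ^ 2)) ^ 4 =
      (((p - 1)! : ZMod (p ^ 2)) ^ m * ∏ j ∈ range m, (m * P + ((j : ZMod (p ^ 2)) + 1))) ^ 4 := by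
    have h1 := congrArg (Nat.cast : ℕ → ZMod (p ^ 2))
      (prod_range_filter_not_dvd hp.out.one_lt m (r := m) (by omega))
    push_cast at h1
    simp only [← hPdef, hblock, ← hQ] at h1
    rw [prod_const, card_range] at h1
    rw [gammaNat]
    push_cast
    rw [h1, mul_pow, ← pow_mul, (Nat.even_mul.2 (Or.inr ⟨2, rfl⟩)).neg_one_pow, one_mul]
  -- each factor satisfies `(m P + j) ^ 2 = j (j - P / 2)`, because `4 m = P - 1`
  have hT : (∏ j ∈ range m, (m * P + ((j : ZMod (p ^ 2)) + 1))) ^ 2 =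
      (∏ j ∈ range m, ((j : ZMod (p ^ 2)) + 1)) * ∏ j ∈ range m, ((j : ZMod (p ^ 2)) + 1 - h * P) := by
    rw [← prod_pow, ← prod_mul_distrib]
    refine prod_congr rfl fun j _ => ?_
    have h1 : (m : ZMod (p ^ 2)) * P = -(h ^ 2 * P) := by
      linear_combination h ^ 2 * P * hmP + h ^ 2 * hP - (m : ZMod (p ^ 2)) * P * (2 * h + 1) * hh
    rw [h1]
    linear_combination h ^ 4 * hP - ((j : ZMod (p ^ 2)) + 1) * h * P * hh
  -- reflecting `i ↦ 2 m - 1 - i` turns `i + 1 / 2` into `P / 2 - (i + 1)`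
  have hD : (∏ i ∈ range m, ((i : ZMod (p ^ 2)) + h)) ^ 2 *
      (∏ j ∈ range m, ((j : ZMod (p ^ 2)) + 1 - h * P)) ^ 2 = ((p - 1)! : ZMod (p ^ 2)) := by
    rw [hQ, prod_range_two_mul, ← prod_pow, ← prod_pow, ← prod_mul_distrib]
    refine prod_congr rfl fun i hi => ?_
    have := mem_range.1 hi
    have h1 : ((2 * m - 1 - i : ℕ) : ZMod (p ^ 2)) + 1 = h * P - h - i := by
      rw [Nat.sub_sub, Nat.cast_sub (by omega)]
      push_cast
      linear_combination h * hmP - 2 * (m : ZMod (p ^ 2)) * hh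
    have h2 : ((i : ZMod (p ^ 2)) + 1) * (P - (i + 1)) = -((i : ZMod (p ^ 2)) + 1 - h * P) ^ 2 := by
      linear_combination h ^ 2 * hP - ((i : ZMod (p ^ 2)) + 1) * P * hh
    have h3 : (h * P - h - i) * (P - (h * P - h - i)) = -((i : ZMod (p ^ 2)) + h) ^ 2 := by
      linear_combination (h - h ^ 2) * hP + (-P * (h * P - h - i) + h * P ^ 2) * hh
    rw [h1, h2, h3]
    ring
  calc _ = ((∏ i ∈ range m, ((i : ZMod (p ^ 2)) + h)) ^ 2 *
        (∏ j ∈ range m, ((j : ZMod (p ^ 2)) + 1 - h * P)) ^ 2) * ((p - 1)! : ZMod (p ^ 2)) ^ (4 * m) *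
        (∏ i ∈ range m, ((i : ZMod (p ^ 2)) + 1)) ^ 2 := by
        rw [hG]
        generalize ∏ j ∈ range m, (m * P + ((j : ZMod (p ^ 2)) + 1)) = T at *
        generalize ∏ j ∈ range m, ((j : ZMod (p ^ 2)) + 1) = F at *
        generalize ∏ j ∈ range m, ((j : ZMod (p ^ 2)) + 1 - h * P) = E at *
        generalize ∏ j ∈ range m, ((j : ZMod (p ^ 2)) + h) = D at *
        rw [mul_pow, ← pow_mul, mul_comm m 4, show T ^ 4 = (T ^ 2) ^ 2 by ring, hT]
        ring
    _ = _ := by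
        rw [hD, ← pow_succ', ← hm, hQp]
        ring

end ModSquare

/-! ### Values of the binomial coefficient and of the `p`-adic Gamma function -/

section Values

open Finset

theorem ring_choose_neg_half (k : ℕ) :
    Ring.choose (-1 / 2 : ℚ) k = ∏ i ∈ range k, -(((i : ℚ) + 1 / 2) / (i + 1)) := by
  induction k with
  | zero => simp
  | succ k ih =>
    have h1 : ((k.factorial : ℕ) : ℚ) ≠ 0 := by exact_mod_cast k.factorial_ne_zero
    rw [prod_range_succ, ← ih, Ring.choose_eq_smul, Ring.choose_eq_smul, descPochhammer_succ_right,
      Polynomial.smeval_mul, Polynomial.smeval_sub, Polynomial.smeval_X,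
      Polynomial.smeval_natCast, Nat.factorial_succ]
    simp only [smul_eq_mul, pow_zero, pow_one, nsmul_eq_mul, mul_one]
    push_cast
    field_simp
    ring

theorem toZModPow_eq_zero_iff {p : ℕ} [Fact p.Prime] (k : ℕ) (x : ℤ_[p]) :
    PadicInt.toZModPow k x = 0 ↔ (p : ℤ_[p]) ^ k ∣ x := by
  rw [← RingHom.mem_ker, PadicInt.ker_toZModPow, Ideal.mem_span_singleton]

theorem eventually_toZModPow_eq {p : ℕ} [hp : Fact p.Prime] (k : ℕ) (x : ℤ_[p]) :
    ∀ᶠ y in 𝓝 x, PadicInt.toZModPow k y = PadicInt.toZModPow k x := by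
  have hpos : (0 : ℝ) < (p : ℝ) ^ (-(k : ℤ)) := zpow_pos (by exact_mod_cast hp.out.pos) _
  filter_upwards [Metric.ball_mem_nhds x hpos] with y hy
  rw [← sub_eq_zero, ← map_sub, ← RingHom.mem_ker, PadicInt.ker_toZModPow,
    ← PadicInt.norm_le_pow_iff_mem_span_pow, ← dist_eq_norm]
  exact (Metric.mem_ball.1 hy).le

/-- Modulo `p ^ k`, the `p`-adic Gamma function may be evaluated at any natural number congruent to
the argument. -/
theorem toZModPow_padicGamma {p : ℕ} [hp : Fact p.Prime] (hp2 : p ≠ 2) {k N : ℕ} {x : ℤ_[p]}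
    (hN : (N : ZMod (p ^ k)) = PadicInt.toZModPow k x) :
    PadicInt.toZModPow k (padicGamma p x) = gammaNat p N := by
  have hne : NeBot (comap (Nat.cast : ℕ → ℤ_[p]) (𝓝 x)) :=
    comap_neBot_iff.2 fun _ hs => PadicInt.denseRange_natCast.mem_nhds hs
  have h1 := (tendsto_gammaNat p hp2 x).eventually (eventually_toZModPow_eq k (padicGamma p x))
  have h2 := (tendsto_comap (f := (Nat.cast : ℕ → ℤ_[p]))).eventually (eventually_toZModPow_eq k x)
  obtain ⟨n, hn1, hn2⟩ := (h1.and h2).exists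
  rw [← hn1, map_intCast]
  rw [map_natCast, ← hN] at hn2
  exact gammaNat_congr p k hp2 ((ZMod.natCast_eq_natCast_iff _ _ _).1 hn2)

end Values

/-! ### Congruences in `ℚ_[p]` -/

section Congruence

open Finset

variable {p : ℕ} [hp : Fact p.Prime]

theorem CongrModPow.refl (m : ℕ) (a : ℚ_[p]) : CongrModPow p m a a := ⟨0, by simp⟩

theorem CongrModPow.symm {m : ℕ} {a b : ℚ_[p]} (h : CongrModPow p m a b) :
    CongrModPow p m b a := by
  obtain ⟨x, hx⟩ := h
  exact ⟨-x, by push_cast; linear_combination -hx⟩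

theorem CongrModPow.trans {m : ℕ} {a b c : ℚ_[p]} (h1 : CongrModPow p m a b)
    (h2 : CongrModPow p m b c) : CongrModPow p m a c := by
  obtain ⟨x, hx⟩ := h1
  obtain ⟨y, hy⟩ := h2
  exact ⟨x + y, by push_cast; linear_combination hx + hy⟩

theorem congrModPow_of_sub_eq {m : ℕ} {a b c : ℚ_[p]} (hc : ‖c‖ ≤ 1)
    (h : a - b = (p : ℚ_[p]) ^ m * c) : CongrModPow p m a b := ⟨⟨c, hc⟩, h⟩

theorem CongrModPow.exists_norm_le {m : ℕ} {a b : ℚ_[p]} (h : CongrModPow p m a b) :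
    ∃ c : ℚ_[p], ‖c‖ ≤ 1 ∧ a - b = (p : ℚ_[p]) ^ m * c := by
  obtain ⟨c, hc⟩ := h
  exact ⟨c, c.2, hc⟩

theorem norm_mul_le_one {a b : ℚ_[p]} (ha : ‖a‖ ≤ 1) (hb : ‖b‖ ≤ 1) : ‖a * b‖ ≤ 1 := by
  rw [norm_mul]
  exact mul_le_one₀ ha (norm_nonneg _) hb

theorem norm_add_le_one {a b : ℚ_[p]} (ha : ‖a‖ ≤ 1) (hb : ‖b‖ ≤ 1) : ‖a + b‖ ≤ 1 :=
  (Padic.nonarchimedean a b).trans (max_le ha hb)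

theorem CongrModPow.mul {m : ℕ} {a b c d : ℚ_[p]} (hb : ‖b‖ ≤ 1) (hc : ‖c‖ ≤ 1)
    (h1 : CongrModPow p m a b) (h2 : CongrModPow p m c d) :
    CongrModPow p m (a * c) (b * d) := by
  obtain ⟨x, hx, hx'⟩ := h1.exists_norm_le
  obtain ⟨y, hy, hy'⟩ := h2.exists_norm_le
  exact congrModPow_of_sub_eq (norm_add_le_one (norm_mul_le_one hx hc) (norm_mul_le_one hb hy))
    (by linear_combination c * hx' + b * hy')

theorem CongrModPow.sum {ι : Type*} {s : Finset ι} {m : ℕ} {f g : ι → ℚ_[p]}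
    (h : ∀ i ∈ s, CongrModPow p m (f i) (g i)) :
    CongrModPow p m (∑ i ∈ s, f i) (∑ i ∈ s, g i) := by
  classical
  induction s using Finset.induction_on with
  | empty => exact CongrModPow.refl m _
  | insert a s ha ih =>
    obtain ⟨x, hx⟩ := h a (mem_insert_self _ _)
    obtain ⟨y, hy⟩ := ih fun i hi => h i (mem_insert_of_mem hi)
    rw [sum_insert ha, sum_insert ha]
    exact ⟨x + y, by push_cast; linear_combination hx + hy⟩

theorem norm_prod_le_one {ι : Type*} {s : Finset ι} {f : ι → ℚ_[p]} (h : ∀ i ∈ s, ‖f i‖ ≤ 1) :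
    ‖∏ i ∈ s, f i‖ ≤ 1 := by
  rw [norm_prod]
  exact prod_le_one (fun i _ => norm_nonneg _) h

theorem CongrModPow.prod {ι : Type*} {s : Finset ι} {m : ℕ} {f g : ι → ℚ_[p]}
    (h : ∀ i ∈ s, CongrModPow p m (f i) (g i)) (hf : ∀ i ∈ s, ‖f i‖ ≤ 1)
    (hg : ∀ i ∈ s, ‖g i‖ ≤ 1) : CongrModPow p m (∏ i ∈ s, f i) (∏ i ∈ s, g i) := by
  classical
  induction s using Finset.induction_on with
  | empty => exact CongrModPow.refl m _
  | insert a s ha ih =>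
    rw [prod_insert ha, prod_insert ha]
    exact CongrModPow.mul (hg a (mem_insert_self _ _))
      (norm_prod_le_one fun i hi => hf i (mem_insert_of_mem hi)) (h a (mem_insert_self _ _))
      (ih (fun i hi => h i (mem_insert_of_mem hi)) (fun i hi => hf i (mem_insert_of_mem hi))
        fun i hi => hg i (mem_insert_of_mem hi))

theorem CongrModPow.div {m : ℕ} {a b c d : ℚ_[p]} (hb : ‖b‖ ≤ 1) (hc : ‖c‖ = 1) (hd : ‖d‖ = 1)
    (h1 : CongrModPow p m a b) (h2 : CongrModPow p m c d) :
    CongrModPow p m (a / c) (b / d) := by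
  obtain ⟨x, hx, hx'⟩ := h1.exists_norm_le
  obtain ⟨y, hy, hy'⟩ := h2.exists_norm_le
  have hc0 : c ≠ 0 := norm_ne_zero_iff.1 (by rw [hc]; exact one_ne_zero)
  have hd0 : d ≠ 0 := norm_ne_zero_iff.1 (by rw [hd]; exact one_ne_zero)
  refine congrModPow_of_sub_eq (c := (x * d + b * (-y)) / (c * d)) ?_ ?_
  · rw [norm_div, norm_mul c d, hc, hd, one_mul, div_one]
    exact norm_add_le_one (norm_mul_le_one hx hd.le)
      (norm_mul_le_one hb (by rwa [norm_neg]))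
  · field_simp
    linear_combination d * hx' - b * hy'

theorem CongrModPow.norm_le_one {m : ℕ} {a b : ℚ_[p]} (h : CongrModPow p m a b) (ha : ‖a‖ ≤ 1) :
    ‖b‖ ≤ 1 := by
  obtain ⟨c, hc, h⟩ := h.exists_norm_le
  rw [show b = a + p ^ m * -c by linear_combination -h]
  refine norm_add_le_one ha (norm_mul_le_one ?_ (by rwa [norm_neg]))
  rw [norm_pow]
  exact pow_le_one₀ (norm_nonneg _) Padic.norm_p_lt_one.le

theorem CongrModPow.norm_eq_one {m : ℕ} {a b : ℚ_[p]} (h : CongrModPow p m a b) (hm : m ≠ 0)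
    (ha : ‖a‖ = 1) : ‖b‖ = 1 := by
  obtain ⟨c, hc, h⟩ := h.exists_norm_le
  have h1 : ‖(p : ℚ_[p]) ^ m * -c‖ < 1 := by
    rw [norm_mul, norm_pow, norm_neg]
    exact mul_lt_one_of_nonneg_of_lt_one_left (by positivity)
      (pow_lt_one₀ (norm_nonneg _) Padic.norm_p_lt_one hm) hc
  rw [show b = a + p ^ m * -c by linear_combination -h,
    Padic.add_eq_max_of_ne (by rw [ha]; exact h1.ne'), ha, max_eq_left h1.le]

theorem norm_natCast_le_one (k : ℕ) : ‖(k : ℚ_[p])‖ ≤ 1 := by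
  exact_mod_cast Padic.norm_int_le_one (p := p) k

theorem norm_one_half (hp2 : p ≠ 2) : ‖(1 / 2 : ℚ_[p])‖ = 1 := by
  have h : ‖((2 : ℕ) : ℚ_[p])‖ = 1 :=
    Padic.norm_natCast_eq_one_iff.2 ((Nat.coprime_primes hp.out Nat.prime_two).2 hp2)
  rw [norm_div, norm_one]
  push_cast at h
  rw [h, div_one]

theorem norm_natCast_add_one {i : ℕ} (hi : i + 1 < p) : ‖(i : ℚ_[p]) + 1‖ = 1 := by
  rw [← Nat.cast_add_one, Padic.norm_natCast_eq_one_iff]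
  exact Nat.coprime_of_lt_prime i.succ_ne_zero hi hp.out

end Congruence

/-! ### The truncated sum modulo `p ^ 3` -/

section Main

open Finset

variable {p : ℕ} [hp : Fact p.Prime]

theorem cast_truncatedSum {n : ℕ} (hn : p = 2 * n + 1) :
    ((truncatedSum p : ℚ) : ℚ_[p]) = ∑ k ∈ range (n + 1), (4 * (k : ℚ_[p]) + 1) *
      ∏ i ∈ range k, (-(((i : ℚ_[p]) + 1 / 2) / (i + 1))) ^ 5 := by
  rw [truncatedSum, show (p - 1) / 2 = n by omega]
  simp only [ring_choose_neg_half, ← prod_pow]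
  push_cast
  rfl

/-- Whipple's transformation for `Y = -(n + 1 / 2) ^ 2`, transported from `ℚ`, where no denominator
`(i + 1) ^ 2 - Y` vanishes. -/
theorem cast_sum_wellPoisedCoeff (n : ℕ) :
    ∑ k ∈ range (n + 1), (4 * (k : ℚ_[p]) + 1) * ∏ i ∈ range k,
      (-(((i : ℚ_[p]) + 1 / 2) / (i + 1) *
        (((i + 1 / 2) ^ 2 - (n + 1 / 2) ^ 2) / ((i + 1) ^ 2 - (n + 1 / 2) ^ 2))) *
          (((i + 1 / 2) ^ 2 + (n + 1 / 2) ^ 2) / ((i + 1) ^ 2 + (n + 1 / 2) ^ 2))) =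
      (2 * n + 1) * ((-1) ^ n * ∑ j ∈ range (n + 1), ∏ i ∈ range j, ((i : ℚ_[p]) + 1 / 2) *
        (i - n) * (i + n + 1) / ((i + 1) * ((i + 1) ^ 2 + (n + 1 / 2) ^ 2))) := by
  have h := sum_wellPoisedCoeff_mul_prod_div (K := ℚ) n (-(n + 1 / 2) ^ 2) fun i => by
    rw [sub_neg_eq_add]
    positivity
  have h2 := congrArg (Rat.cast : ℚ → ℚ_[p]) h
  simp only [wellPoisedCoeff, mul_assoc, ← prod_mul_distrib, sub_neg_eq_add] at h2
  push_cast at h2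
  simpa only [mul_assoc] using h2

theorem CongrModPow.const_mul {m : ℕ} {a b c : ℚ_[p]} (hc : ‖c‖ ≤ 1) (h : CongrModPow p m a b) :
    CongrModPow p m (c * a) (c * b) := by
  obtain ⟨x, hx, hx'⟩ := h.exists_norm_le
  exact congrModPow_of_sub_eq (norm_mul_le_one hc hx) (by linear_combination c * hx')

/-- With `x = p / 2`, the parameters `x²` and `Y = -x²` make the term-by-term difference to the
truncated sum a function of `x ^ 4`, so Whipple's transformation gives the truncated sum modulo
`p ^ 3`. On the other side the prefactor `2 n + 1 = p` leaves only a congruence modulo `p ^ 2`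
to check. -/
theorem truncatedSum_congrModPow {n : ℕ} (hn : p = 2 * n + 1) :
    CongrModPow p 3 ((truncatedSum p : ℚ) : ℚ_[p])
      ((p : ℚ_[p]) * ((-1) ^ n * legendreSum ℚ_[p] n)) := by
  have hp2 : p ≠ 2 := by omega
  have hhalf := norm_one_half hp2
  have hx : (n : ℚ_[p]) + 1 / 2 = (p : ℚ_[p]) * (1 / 2) := by
    have := congrArg (Nat.cast : ℕ → ℚ_[p]) hn
    push_cast at this
    rw [this]
    ring
  have hcast : 2 * (n : ℚ_[p]) + 1 = p := by linear_combination 2 * hx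
  have hA : ∀ i : ℕ, ‖(i : ℚ_[p]) + 1 / 2‖ ≤ 1 := fun i =>
    norm_add_le_one (norm_natCast_le_one i) hhalf.le
  have hhalf_pow : ∀ r : ℕ, ‖(1 / 2 : ℚ_[p]) ^ r‖ ≤ 1 := fun r => by
    rw [norm_pow, hhalf, one_pow]
  have hB : ∀ {i k : ℕ}, k ∈ range (n + 1) → i ∈ range k → ‖(i : ℚ_[p]) + 1‖ = 1 := by
    intro i k hk hi
    rw [mem_range] at hk hi
    exact norm_natCast_add_one (by omega)
  have h1 : CongrModPow p 3 ((truncatedSum p : ℚ) : ℚ_[p])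
      ((2 * n + 1) * ((-1) ^ n * ∑ j ∈ range (n + 1), ∏ i ∈ range j, ((i : ℚ_[p]) + 1 / 2) *
        (i - n) * (i + n + 1) / ((i + 1) * ((i + 1) ^ 2 + (n + 1 / 2) ^ 2)))) := by
    rw [cast_truncatedSum hn, ← cast_sum_wellPoisedCoeff, hx]
    refine CongrModPow.sum fun k hk => ?_
    have hpf : ∀ i ∈ range k, CongrModPow p 3 ((-(((i : ℚ_[p]) + 1 / 2) / (i + 1))) ^ 5)
        (-(((i : ℚ_[p]) + 1 / 2) / (i + 1) * (((i + 1 / 2) ^ 2 - (p * (1 / 2)) ^ 2) /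
          ((i + 1) ^ 2 - (p * (1 / 2)) ^ 2))) * (((i + 1 / 2) ^ 2 + (p * (1 / 2)) ^ 2) /
            ((i + 1) ^ 2 + (p * (1 / 2)) ^ 2))) ∧
        ‖(-(((i : ℚ_[p]) + 1 / 2) / (i + 1))) ^ 5‖ ≤ 1 ∧
        ‖(-(((i : ℚ_[p]) + 1 / 2) / (i + 1) * (((i + 1 / 2) ^ 2 - (p * (1 / 2)) ^ 2) /
          ((i + 1) ^ 2 - (p * (1 / 2)) ^ 2))) * (((i + 1 / 2) ^ 2 + (p * (1 / 2)) ^ 2) /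
            ((i + 1) ^ 2 + (p * (1 / 2)) ^ 2)))‖ ≤ 1 := by
      intro i hi
      have ha := hA i
      have hb := hB hk hi
      generalize (i : ℚ_[p]) + 1 / 2 = a at *
      generalize (i : ℚ_[p]) + 1 = b at *
      have e1 : (-(a / b)) ^ 5 = -(a ^ 5) / b ^ 5 := by rw [← neg_div, div_pow]; ring
      have e2 : (-(a / b * ((a ^ 2 - (p * (1 / 2)) ^ 2) / (b ^ 2 - (p * (1 / 2)) ^ 2))) *
          ((a ^ 2 + (p * (1 / 2)) ^ 2) / (b ^ 2 + (p * (1 / 2)) ^ 2))) =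
          -(a * (a ^ 4 - (p * (1 / 2)) ^ 4)) / (b * (b ^ 4 - (p * (1 / 2)) ^ 4)) := by
        rw [show b * (b ^ 4 - ((p : ℚ_[p]) * (1 / 2)) ^ 4) = b * ((b ^ 2 - (p * (1 / 2)) ^ 2) *
          (b ^ 2 + (p * (1 / 2)) ^ 2)) by ring]
        simp only [div_eq_mul_inv, mul_inv]
        ring
      have hb5 : ‖b ^ 5‖ = 1 := by rw [norm_pow, hb, one_pow]
      have ha5 : ‖-(a ^ 5)‖ ≤ 1 := by
        rw [norm_neg, norm_pow]
        exact pow_le_one₀ (norm_nonneg _) ha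
      have hpp := norm_natCast_le_one (p := p) p
      have hnum : CongrModPow p 3 (-(a ^ 5)) (-(a * (a ^ 4 - (p * (1 / 2)) ^ 4))) :=
        congrModPow_of_sub_eq (c := -((1 / 2) ^ 4) * (p * a))
          (norm_mul_le_one (by rw [norm_neg]; exact hhalf_pow 4) (norm_mul_le_one hpp ha)) (by ring)
      have hden : CongrModPow p 3 (b ^ 5) (b * (b ^ 4 - (p * (1 / 2)) ^ 4)) :=
        congrModPow_of_sub_eq (c := (1 / 2) ^ 4 * (p * b))
          (norm_mul_le_one (hhalf_pow 4) (norm_mul_le_one hpp hb.le)) (by ring)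
      rw [e1, e2]
      have hn' := hnum.norm_le_one ha5
      have hd' := hden.norm_eq_one (by norm_num) hb5
      refine ⟨hnum.div hn' hb5 hd' hden, ?_, ?_⟩
      · rwa [norm_div, hb5, div_one]
      · rwa [norm_div, hd', div_one]
    refine CongrModPow.const_mul ?_ (CongrModPow.prod (fun i hi => (hpf i hi).1)
      (fun i hi => (hpf i hi).2.1) fun i hi => (hpf i hi).2.2)
    exact_mod_cast norm_natCast_le_one (p := p) (4 * k + 1)
  refine h1.trans ?_
  rw [hcast]
  have h2 : CongrModPow p 2 (∑ j ∈ range (n + 1), ∏ i ∈ range j, ((i : ℚ_[p]) + 1 / 2) *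
        (i - n) * (i + n + 1) / ((i + 1) * ((i + 1) ^ 2 + (n + 1 / 2) ^ 2)))
      (legendreSum ℚ_[p] n) := by
    rw [hx]
    refine CongrModPow.sum fun k hk => ?_
    have hpf : ∀ i ∈ range k, CongrModPow p 2 (((i : ℚ_[p]) + 1 / 2) *
        (i - n) * (i + n + 1) / ((i + 1) * ((i + 1) ^ 2 + (p * (1 / 2)) ^ 2)))
        (((i : ℚ_[p]) + 1 / 2) * (i - n) * (i + n + 1) / (i + 1) ^ 3) ∧
        ‖((i : ℚ_[p]) + 1 / 2) *
        (i - n) * (i + n + 1) / ((i + 1) * ((i + 1) ^ 2 + (p * (1 / 2)) ^ 2))‖ ≤ 1 ∧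
        ‖((i : ℚ_[p]) + 1 / 2) * (i - n) * (i + n + 1) / (i + 1) ^ 3‖ ≤ 1 := by
      intro i hi
      have hb := hB hk hi
      have ha : ‖((i : ℚ_[p]) + 1 / 2) * (i - n) * (i + n + 1)‖ ≤ 1 := by
        refine norm_mul_le_one (norm_mul_le_one (hA i) ?_) ?_
        · exact_mod_cast Padic.norm_int_le_one (p := p) ((i : ℤ) - n)
        · exact_mod_cast norm_natCast_le_one (p := p) (i + n + 1)
      generalize ((i : ℚ_[p]) + 1 / 2) * (i - n) * (i + n + 1) = a at *
      generalize (i : ℚ_[p]) + 1 = b at *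
      have hb3 : ‖b ^ 3‖ = 1 := by rw [norm_pow, hb, one_pow]
      have hden : CongrModPow p 2 (b ^ 3) (b * (b ^ 2 + (p * (1 / 2)) ^ 2)) :=
        congrModPow_of_sub_eq (c := -((1 / 2) ^ 2) * b)
          (norm_mul_le_one (by rw [norm_neg]; exact hhalf_pow 2) hb.le) (by ring)
      have hd' := hden.norm_eq_one (by norm_num) hb3
      refine ⟨(CongrModPow.refl 2 a).div ha hd' hb3 hden.symm, ?_, ?_⟩
      · rwa [norm_div, hd', div_one]
      · rwa [norm_div, hb3, div_one]
    exact CongrModPow.prod (fun i hi => (hpf i hi).1)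
      (fun i hi => (hpf i hi).2.1) fun i hi => (hpf i hi).2.2
  obtain ⟨c, hc⟩ := h2
  exact ⟨(-1) ^ n * c, by push_cast; linear_combination (p : ℚ_[p]) * (-1) ^ n * hc⟩

theorem natCast_eq_toZModPow_threeFourths {m : ℕ} (hm : p = 4 * m + 1) (hp2 : p ≠ 2) :
    ((m * p + 1 + m : ℕ) : ZMod (p ^ 2)) = PadicInt.toZModPow 2 (threeFourths p hp2) := by
  have h1 : (4 : ℤ_[p]) * threeFourths p hp2 = 3 := by
    apply Subtype.ext
    rw [PadicInt.coe_mul, threeFourths]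
    change ((4 : ℕ) : ℚ_[p]) * (3 / 4) = ((3 : ℕ) : ℚ_[p])
    norm_num
  have h2 := congrArg (PadicInt.toZModPow (p := p) 2) h1
  rw [map_mul, map_ofNat, map_ofNat] at h2
  have h4 : IsUnit (4 : ZMod (p ^ 2)) := by
    have : IsUnit ((4 : ℕ) : ZMod (p ^ 2)) := by
      rw [ZMod.isUnit_iff_coprime]
      exact (Nat.Coprime.pow_left 2 ((Nat.coprime_primes Nat.prime_two hp.out).2 hp2.symm)).pow_right 2
    exact_mod_cast this
  apply h4.mul_left_cancel
  rw [h2]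
  have h5 : 4 * (m * p + 1 + m) = p ^ 2 + 3 := by rw [hm]; ring
  have h6 := congrArg (Nat.cast : ℕ → ZMod (p ^ 2)) h5
  rw [Nat.cast_add, ZMod.natCast_self, zero_add] at h6
  exact_mod_cast h6

/-- The value `w ^ 2` of `legendreSum` at `2 m` is congruent to `-1 / Γ_p(3/4) ^ 4` modulo `p ^ 2`. -/
theorem sq_prod_mul_padicGamma_pow_four {m : ℕ} (hm : p = 4 * m + 1) (hp2 : p ≠ 2) :
    CongrModPow p 2 ((∏ i ∈ range m, ((i : ℚ_[p]) + 1 / 2) / (i + 1)) ^ 2 *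
      (padicGamma p (threeFourths p hp2) : ℚ_[p]) ^ 4) (-1) := by
  set h : ℤ_[p] := ⟨1 / 2, (norm_one_half hp2).le⟩ with hdef
  have hh : (2 : ℤ_[p]) * h = 1 := by
    apply Subtype.ext
    rw [PadicInt.coe_mul, hdef]
    change ((2 : ℕ) : ℚ_[p]) * (1 / 2) = 1
    norm_num
  have h1 := congrArg (PadicInt.toZModPow (p := p) 2) hh
  rw [map_mul, map_ofNat, map_one] at h1
  have h2 := sq_prod_mul_gammaNat_pow_four hm h1
  rw [← toZModPow_padicGamma hp2 (natCast_eq_toZModPow_threeFourths hm hp2)] at h2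
  have h3 : PadicInt.toZModPow 2 ((∏ i ∈ range m, ((i : ℤ_[p]) + h)) ^ 2 *
      padicGamma p (threeFourths p hp2) ^ 4 + (∏ i ∈ range m, ((i : ℤ_[p]) + 1)) ^ 2) = 0 := by
    simp only [map_add, map_mul, map_pow, map_prod, map_natCast, map_one]
    rw [h2]
    ring
  rw [toZModPow_eq_zero_iff] at h3
  obtain ⟨c, hc⟩ := h3
  have hc' := congrArg (PadicInt.Coe.ringHom (p := p)) hc
  have hcoe : PadicInt.Coe.ringHom h = (1 / 2 : ℚ_[p]) := rfl
  have hF : ‖∏ i ∈ range m, ((i : ℚ_[p]) + 1)‖ = 1 := by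
    rw [norm_prod]
    refine prod_eq_one fun i hi => norm_natCast_add_one ?_
    have := mem_range.1 hi
    omega
  have hF0 : ∏ i ∈ range m, ((i : ℚ_[p]) + 1) ≠ 0 := norm_ne_zero_iff.1 (by rw [hF]; exact one_ne_zero)
  simp only [map_add, map_mul, map_pow, map_prod, map_natCast, map_one, hcoe] at hc'
  change _ * (padicGamma p (threeFourths p hp2) : ℚ_[p]) ^ 4 + _ = _ * (c : ℚ_[p]) at hc'
  rw [prod_div_distrib]
  refine congrModPow_of_sub_eq (c := c / (∏ i ∈ range m, ((i : ℚ_[p]) + 1)) ^ 2) ?_ ?_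
  · rw [norm_div, norm_pow, hF, one_pow, div_one]
    exact c.2
  · generalize ∏ i ∈ range m, ((i : ℚ_[p]) + 1) = F at *
    generalize ∏ i ∈ range m, ((i : ℚ_[p]) + 1 / 2) = D at *
    field_simp
    linear_combination hc'

theorem truncatedSum_congrModPow_of_mod_four_eq_one (hp2 : p ≠ 2) (h : p % 4 = 1) :
    CongrModPow p 3 ((truncatedSum p : ℚ) : ℚ_[p])
      (-(p : ℚ_[p]) / (padicGamma p (threeFourths p hp2) : ℚ_[p]) ^ 4) := by
  have hm : p = 4 * (p / 4) + 1 := by omega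
  generalize p / 4 = m at hm
  refine (truncatedSum_congrModPow (n := 2 * m) (by omega)).trans ?_
  rw [legendreSum_even, (even_two_mul m).neg_one_pow, one_mul]
  have hW := sq_prod_mul_padicGamma_pow_four hm hp2
  have hw1 : ‖(∏ i ∈ range m, ((i : ℚ_[p]) + 1 / 2) / (i + 1)) ^ 2‖ ≤ 1 := by
    rw [norm_pow]
    refine pow_le_one₀ (norm_nonneg _) (norm_prod_le_one fun i hi => ?_)
    have := mem_range.1 hi
    rw [norm_div, norm_natCast_add_one (by omega), div_one]
    exact norm_add_le_one (norm_natCast_le_one i) (norm_one_half hp2).le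
  have hg1 : ‖(padicGamma p (threeFourths p hp2) : ℚ_[p]) ^ 4‖ ≤ 1 := by
    rw [norm_pow]
    exact pow_le_one₀ (norm_nonneg _) (padicGamma p (threeFourths p hp2)).2
  have hwg := hW.symm.norm_eq_one two_ne_zero (by simp)
  obtain ⟨c, hc, hc'⟩ := hW.exists_norm_le
  generalize (padicGamma p (threeFourths p hp2) : ℚ_[p]) ^ 4 = g at *
  generalize (∏ i ∈ range m, ((i : ℚ_[p]) + 1 / 2) / (i + 1)) ^ 2 = w at *
  rw [norm_mul] at hwg
  have hg : ‖g‖ = 1 := le_antisymm hg1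
    (hwg ▸ mul_le_of_le_one_left (norm_nonneg _) hw1)
  have hg0 : g ≠ 0 := norm_ne_zero_iff.1 (by rw [hg]; exact one_ne_zero)
  refine congrModPow_of_sub_eq (c := c / g) (by rwa [norm_div, hg, div_one]) ?_
  field_simp
  linear_combination (p : ℚ_[p]) * hc'

theorem truncatedSum_congrModPow_of_mod_four_eq_three (h : p % 4 = 3) :
    CongrModPow p 3 ((truncatedSum p : ℚ) : ℚ_[p]) 0 := by
  have hm : p = 2 * (2 * (p / 4) + 1) + 1 := by omega
  have := truncatedSum_congrModPow hm
  rwa [legendreSum_odd, mul_zero, mul_zero] at this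

end Main

end PadicGamma

theorem theorem1p2 (p : ℕ) [Fact p.Prime] (hp2 : p ≠ 2) :
    (p % 4 = 1 →
      PadicGamma.CongrModPow p 3 ((PadicGamma.truncatedSum p : ℚ) : ℚ_[p])
        (-(p : ℚ_[p]) /
          (PadicGamma.padicGamma p (PadicGamma.threeFourths p hp2) : ℚ_[p]) ^ 4)) ∧
    (p % 4 = 3 →
      PadicGamma.CongrModPow p 3 ((PadicGamma.truncatedSum p : ℚ) : ℚ_[p]) 0) := by
  exact ⟨PadicGamma.truncatedSum_congrModPow_of_mod_four_eq_one hp2,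
    PadicGamma.truncatedSum_congrModPow_of_mod_four_eq_three⟩
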